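/- Let $k$ be an algebraically closed field, let $S$ be a variety over $k$ (a reduced separated scheme of finite type over $k$, of any dimension), and let $U\subset S$ be an affine open subset. Let $p\colon X\to S$ be a desingularization, i.e. a proper birational morphism with $X$ nonsingular. Let the exceptional set of $p$ be the complement in $X$ of $p^{-1}(V)$, where $V$ is the largest open subset of $S$ over which $p$ is an isomorphism; its irreducible components are called the exceptional components, and those of codimension one the exceptional divisors. Let $E_i,E_j$ be exceptional divisors with $p^{-1}(U)\cap E_i\neq\emptyset$ and $p^{-1}(U)\cap E_j\neq\emptyset$. For $f\in\mathcal O_S(U)$ and $l\in\{i,j\}$, let $\mathrm{ord}_{E_l}(f)\in\mathbb N\cup\{\infty\}$ be the order of vanishing of $p^*(f)$ along $E_l$. An arc on $S$ is a $k$-morphism $\varphi\colon \mathrm{Spec}\,k[[t]]\to S$. The set $\mathcal H$ of arcs on $S$ carries the Zariski topology: its open sets are generated by the sets $\{\varphi : \varphi(0)\in W,\ P(\varphi)\neq 0\}$, where $W\subset S$ is affine open and $P$ is a polynomial over $k$ in finitely many coefficients of power series $\varphi^*(g)$ with $g\in\mathcal O_S(W)$. The strict transform of an arc $\varphi$ is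 a lift of $\varphi$ to an arc on $X$ whose generic point lies outside the exceptional set. For $l\in\{i,j\}$, let $N_l\subset\mathcal H$ be the set of arcs that have a strict transform which is transverse to $E_l$ (its origin lies on $E_l$ and a local equation of $E_l$ there pulls back to a power series of order exactly $1$ in $t$) and which meets no other exceptional component. If there is $f\in\mathcal O_S(U)$ with $\mathrm{ord}_{E_i}(f)<\mathrm{ord}_{E_j}(f)$, then $\overline{N_i}\not\subset\overline{N_j}$, where the closures are taken in $\mathcal H$. -/

import Mathlib

open CategoryTheory AlgebraicGeometry

universe u

namespace NashArcs

noncomputable section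

/-- The formal disc `Spec k[[t]]`. -/
abbrev disc (k : Type u) [Field k] : Scheme.{u} := Spec (CommRingCat.of (PowerSeries k))

/-- The closed point `0` of `Spec k[[t]]`. -/
def discClosed (k : Type u) [Field k] : disc k := IsLocalRing.closedPoint (PowerSeries k)

/-- The generic point of `Spec k[[t]]`. -/
def discGeneric (k : Type u) [Field k] : disc k :=
  (⟨⊥, Ideal.isPrime_bot⟩ : PrimeSpectrum (PowerSeries k))

/-- An arc on the `k`-scheme `s : S ⟶ Spec k`: a `k`-morphism `Spec k[[t]] ⟶ S`. -/
structure Arc {k : Type u} [Field k] {S : Scheme.{u}} (s : S ⟶ Spec (CommRingCat.of k)) where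
  /-- the underlying morphism of schemes -/
  hom : disc k ⟶ S
  /-- it is a morphism over `k` -/
  comp_eq : hom ≫ s = Spec.map (CommRingCat.ofHom (algebraMap k (PowerSeries k)))

namespace Arc

variable {k : Type u} [Field k] {S : Scheme.{u}} {s : S ⟶ Spec (CommRingCat.of k)}

/-- The origin of an arc: the image of the closed point of `Spec k[[t]]`. -/
def origin (φ : Arc s) : S := φ.hom (discClosed k)

/-- The homomorphism `𝒪_{S, φ(0)} ⟶ k[[t]]` given by an arc `φ`. -/
def pullbackGerm (φ : Arc s) : S.presheaf.stalk φ.origin →+* PowerSeries k :=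
  (Scheme.stalkClosedPointTo (R := CommRingCat.of (PowerSeries k)) φ.hom).hom

/-- The power series `φ^*(g)`, for `g` a function on an open set `U` containing `φ(0)`. -/
def pullback (φ : Arc s) (U : S.Opens) (hU : φ.origin ∈ U) (g : Γ(S, U)) : PowerSeries k :=
  φ.pullbackGerm (S.presheaf.germ U φ.origin hU g)

/-- The arcs with origin in `U` that satisfy the inequation `P ≠ 0`, where `P` is a polynomial in
(finitely many of) the coefficients of the power series `φ^*(g)`, `g ∈ Γ(S, U)`. The variable
`(g, n)` stands for the `n`-th coefficient of `φ^*(g)`. -/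
def inequation (s : S ⟶ Spec (CommRingCat.of k)) (U : S.Opens)
    (P : MvPolynomial (Γ(S, U) × ℕ) k) : Set (Arc s) :=
  {φ | ∃ hU : φ.origin ∈ U,
    MvPolynomial.eval (fun v => PowerSeries.coeff v.2 (φ.pullback U hU v.1)) P ≠ 0}

/-- The Zariski topology on the space of arcs: the open sets are generated by the polynomial
inequations in the coefficients of the power series that define the arcs, in affine charts. -/
instance : TopologicalSpace (Arc s) :=
  TopologicalSpace.generateFrom
    {W | ∃ U : S.Opens, IsAffineOpen U ∧
      ∃ P : MvPolynomial (Γ(S, U) × ℕ) k, W = inequation s U P}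

end Arc

section Resolution

variable {X S : Scheme.{u}}

/-- A desingularization: a proper birational morphism from a nonsingular scheme. Birational means
that `p` restricts to an isomorphism from a dense open `p⁻¹(V)` onto a dense open `V`. -/
structure IsDesingularization (p : X ⟶ S) : Prop where
  isProper : IsProper p
  isRegular : ∀ x : X, IsRegularLocalRing (X.presheaf.stalk x)
  birational : ∃ V : S.Opens, Dense (V : Set S) ∧ Dense ((p ⁻¹ᵁ V : X.Opens) : Set X) ∧
    IsIso (p ∣_ V)

/-- The exceptional set: the complement of `p⁻¹(V)`, for `V` the largest open subset of `S` over
which `p` is an isomorphism. -/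
def exceptionalLocus (p : X ⟶ S) : Set X :=
  {x | ∀ V : S.Opens, p x ∈ V → ¬ IsIso (p ∣_ V)}

/-- The exceptional components: the irreducible components of the exceptional set. -/
def IsExceptionalComponent (p : X ⟶ S) (E : Set X) : Prop :=
  Maximal (fun Z : Set X => IsClosed Z ∧ IsIrreducible Z ∧ Z ⊆ exceptionalLocus p) E

/-- An exceptional divisor of `p`: an exceptional component of codimension one. The generic point
is recorded; it is determined by the underlying closed set. -/
structure ExceptionalDivisor (p : X ⟶ S) where
  /-- the underlying closed subset -/
  carrier : Set X
  isComponent : IsExceptionalComponent p carrier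
  /-- the generic point -/
  genericPoint : X
  isGenericPoint : IsGenericPoint genericPoint carrier
  codim_one : ringKrullDim (X.presheaf.stalk genericPoint) = 1

namespace ExceptionalDivisor

variable {p : X ⟶ S} (E : ExceptionalDivisor p)

theorem genericPoint_mem {U : S.Opens}
    (h : (((p ⁻¹ᵁ U : X.Opens) : Set X) ∩ E.carrier).Nonempty) : E.genericPoint ∈ p ⁻¹ᵁ U :=
  (E.isGenericPoint.mem_open_set_iff (p ⁻¹ᵁ U).isOpen).2 (by rwa [Set.inter_comm])

/-- `ord_E(f)`, for `f ∈ 𝒪_S(U)` with `p⁻¹(U) ∩ E` non-empty: the order of vanishing of `p^*(f)`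
along `E`, that is, in the one-dimensional local ring of `X` at the generic point of `E`. -/
def ord (U : S.Opens) (h : (((p ⁻¹ᵁ U : X.Opens) : Set X) ∩ E.carrier).Nonempty)
    (f : Γ(S, U)) : ℕ∞ :=
  Ring.ord (X.presheaf.stalk E.genericPoint)
    (X.presheaf.germ (p ⁻¹ᵁ U) E.genericPoint (E.genericPoint_mem h) (p.app U f))

/-- The ideal of `E` in `𝒪_{X, x}`, for a point `x` of `E`: the germs that vanish at the generic
point of `E`. -/
def idealAt (x : X) (h : E.genericPoint ⤳ x) : Ideal (X.presheaf.stalk x) :=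
  (IsLocalRing.maximalIdeal (X.presheaf.stalk E.genericPoint)).comap
    (X.presheaf.stalkSpecializes h).hom

variable {k : Type u} [Field k] {s : S ⟶ Spec (CommRingCat.of k)}

/-- The arc `ψ` on `X` is transverse to `E`: its origin lies on `E` and the intersection number
of `ψ` with `E` is one, that is, the ideal of `E` pulls back to the ideal `(t)` of `k[[t]]`. -/
def IsTransverse (ψ : Arc (p ≫ s)) : Prop :=
  ∃ h : E.genericPoint ⤳ ψ.origin,
    (E.idealAt ψ.origin h).map ψ.pullbackGerm = Ideal.span {(PowerSeries.X : PowerSeries k)}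

end ExceptionalDivisor

variable {k : Type u} [Field k]

/-- The arc `ψ` on `X` is the strict transform of the arc `φ` on `S`: it lifts `φ` and its generic
point lies outside the exceptional set. -/
def IsStrictTransform (p : X ⟶ S) {s : S ⟶ Spec (CommRingCat.of k)}
    (φ : Arc s) (ψ : Arc (p ≫ s)) : Prop :=
  ψ.hom ≫ p = φ.hom ∧ ψ.hom (discGeneric k) ∉ exceptionalLocus p

/-- The family `N_E` of the arcs on `S` whose strict transform is transverse to `E` and does not
meet any other exceptional component. -/
def arcFamily {p : X ⟶ S} (s : S ⟶ Spec (CommRingCat.of k)) (E : ExceptionalDivisor p) :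
    Set (Arc s) :=
  {φ | ∃ ψ : Arc (p ≫ s), IsStrictTransform p φ ψ ∧ E.IsTransverse ψ ∧
    ∀ E' : Set X, IsExceptionalComponent p E' → E' ≠ E.carrier →
      Disjoint (Set.range ψ.hom) E'}

end Resolution

end

end NashArcs

/-! Let `n` be the order of `f` along `E_i`. The arcs with origin in `U` for which the coefficient
of `t^n` in `φ^*(f)` is nonzero form an open set. It misses `N_j` and meets `N_i`, so some arc of
`N_i` lies outside the closure of `N_j`.

It misses `N_j` because an arc transverse to `E_j` gives `f` order at least `n + 1`. At its origin,
transversality forces the ideal of `E_j` to contain an element `h` outside `𝔪²`. Then `h` generates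
that ideal, and a power of `h` that divides `f` at the generic point of `E_j` already divides it at
the origin (`X_pow_dvd_map_of_le_ord`). This uses that regular local rings are domains.

It meets `N_i` because at a general closed point of `E_i` a uniformizer `h` along `E_i` stays
outside `𝔪²` (`exists_forall_mul_notMem_sq`), and `f` is a unit times `h^n`. Dividing by the other
members of a regular system of parameters and expanding in powers of `h` gives an arc with `h ↦ t`
(`exists_algHom_of_isRegularLocalRing`), along which `f` has order exactly `n`. -/

/-! ### Regular local rings and their parameters. -/

namespace IsLocalRing

/-- In a Noetherian local ring, an element of `𝔪 ∖ 𝔪²` is part of a minimal system of generators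
of `𝔪`. -/
theorem exists_finset_span_insert_eq_maximalIdeal {R : Type*} [CommRing R] [IsLocalRing R]
    [IsNoetherianRing R] {h : R} (hm : h ∈ maximalIdeal R) (h2 : h ∉ maximalIdeal R ^ 2) :
    ∃ s : Finset R, s.card + 1 ≤ (maximalIdeal R).spanFinrank ∧
      Ideal.span (insert h (s : Set R)) = maximalIdeal R := by
  classical
  set v : CotangentSpace R := (maximalIdeal R).toCotangent ⟨h, hm⟩ with hv
  have hv0 : v ≠ 0 := fun e => h2 (((maximalIdeal R).toCotangent_eq_zero _).1 e)
  have hli : LinearIndepOn (ResidueField R) id ({v} : Set (CotangentSpace R)) :=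
    LinearIndepOn.singleton hv0
  -- The class of `h` extends to a basis of `𝔪/𝔪²`; lifts of the other basis vectors form the
  -- finset, and Nakayama gives generation.
  let b := Module.Basis.extend hli
  have hfin : Finite (hli.extend (Set.subset_univ _)) := Module.Finite.finite_basis b
  have hvmem : v ∈ hli.extend (Set.subset_univ _) := hli.subset_extend _ rfl
  have hfs : (hli.extend (Set.subset_univ {v})).Finite := hfin
  let t : Finset (CotangentSpace R) := hfs.toFinset.erase v
  choose g hg using (maximalIdeal R).toCotangent_surjective
  let T : Finset (maximalIdeal R) := t.image g
  refine ⟨T.image Subtype.val, ?_, ?_⟩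
  · have h1 : (T.image Subtype.val).card ≤ t.card :=
      Finset.card_image_le.trans Finset.card_image_le
    have h3 : t.card + 1 = hfs.toFinset.card :=
      Finset.card_erase_add_one (hfs.mem_toFinset.2 hvmem)
    have h4 : hfs.toFinset.card = Module.finrank (ResidueField R) (CotangentSpace R) := by
      rw [Module.finrank_eq_nat_card_basis b, ← Set.ncard_eq_toFinset_card _ hfs]
      rfl
    rw [spanFinrank_maximalIdeal_eq_finrank_cotangentSpace]
    lia
  · have key : Submodule.span (ResidueField R)
        ((maximalIdeal R).toCotangent '' (insert ⟨h, hm⟩ (T : Set (maximalIdeal R)))) = ⊤ := by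
      rw [eq_top_iff, ← b.span_eq]
      refine Submodule.span_mono ?_
      rintro _ ⟨i, rfl⟩
      have hbi : b i = i := Module.Basis.extend_apply_self hli i
      rw [hbi]
      by_cases hi : (i : CotangentSpace R) = v
      · exact ⟨⟨h, hm⟩, Set.mem_insert _ _, hi.symm⟩
      · refine ⟨g i, Set.mem_insert_of_mem _ ?_, hg _⟩
        exact Finset.mem_coe.2 (Finset.mem_image_of_mem _
          (Finset.mem_erase.2 ⟨hi, hfs.mem_toFinset.2 i.2⟩))
    rw [CotangentSpace.span_image_eq_top_iff] at key
    have := congrArg (Submodule.map (Submodule.subtype _)) key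
    rw [Submodule.map_span, Submodule.map_top, Submodule.range_subtype, Set.image_insert_eq] at this
    simpa using! this

end IsLocalRing

namespace IsRegularLocalRing

open IsLocalRing

variable {R : Type*} [CommRing R] [IsRegularLocalRing R]

/-- Killing `h` removes a generator of the maximal ideal, while the dimension drops by at most one,
so the number of generators is still at most the dimension. -/
theorem quotient_span_singleton {h : R} (hm : h ∈ maximalIdeal R) (h2 : h ∉ maximalIdeal R ^ 2) :
    ∃ _ : IsRegularLocalRing (R ⧸ Ideal.span {h}),
      (maximalIdeal (R ⧸ Ideal.span {h})).spanFinrank < (maximalIdeal R).spanFinrank := by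
  classical
  obtain ⟨s, hs, hspan⟩ := exists_finset_span_insert_eq_maximalIdeal hm h2
  have hle : Ideal.span {h} ≤ maximalIdeal R := by simpa [Ideal.span_le] using hm
  have : Nontrivial (R ⧸ Ideal.span {h}) :=
    Ideal.Quotient.nontrivial_iff.2 (ne_top_of_le_ne_top (Ideal.IsPrime.ne_top inferInstance) hle)
  have : IsLocalRing (R ⧸ Ideal.span {h}) :=
    IsLocalRing.of_surjective' (Ideal.Quotient.mk _) Ideal.Quotient.mk_surjective
  have hmax : maximalIdeal (R ⧸ Ideal.span {h}) =
      Ideal.span (Ideal.Quotient.mk (Ideal.span {h}) '' (s : Set R)) := by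
    rw [← IsLocalRing.map_maximalIdeal_of_surjective _ (Ideal.Quotient.mk_surjective
      (I := Ideal.span {h})), ← hspan, Ideal.map_span, Set.image_insert_eq,
      Ideal.Quotient.eq_zero_iff_mem.2 (Ideal.mem_span_singleton_self h)]
    exact Submodule.span_insert_zero
  have hrank : (maximalIdeal (R ⧸ Ideal.span {h})).spanFinrank ≤ s.card := by
    rw [hmax]
    refine (Submodule.spanFinrank_span_le_ncard_of_finite (s.finite_toSet.image _)).trans ?_
    exact (Set.ncard_image_le s.finite_toSet).trans_eq (Set.ncard_coe_finset s)
  have hdim : ringKrullDim R ≤ ringKrullDim (R ⧸ Ideal.span {h}) + 1 := by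
    have := ringKrullDim_le_ringKrullDim_quotient_add_card ({h} : Finset R)
      (by simpa [ringJacobson_eq_maximalIdeal] using hm)
    rwa [Finset.coe_singleton, Finset.card_singleton, Nat.cast_one] at this
  refine ⟨of_spanFinrank_maximalIdeal_le _ ?_, by lia⟩
  have h3 : ((s.card : ℕ) : WithBot ℕ∞) + 1 ≤ ringKrullDim (R ⧸ Ideal.span {h}) + 1 := by
    refine le_trans ?_ hdim
    rw [← spanFinrank_maximalIdeal]
    exact_mod_cast hs
  have h4 : ((s.card : ℕ) : WithBot ℕ∞) ≤ ringKrullDim (R ⧸ Ideal.span {h}) :=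
    ENat.WithBot.add_le_add_natCast_right_iff.1 h3
  exact le_trans (by exact_mod_cast hrank) h4

/-- Regular local rings are domains. -/
theorem isDomain (R : Type*) [CommRing R] [IsRegularLocalRing R] : IsDomain R := by
  induction hn : (maximalIdeal R).spanFinrank using Nat.strong_induction_on generalizing R with
  | _ n ih =>
  by_cases hbot : maximalIdeal R = ⊥
  · exact ((isField_iff_maximalIdeal_eq).2 hbot).isDomain
  have hmin : ∀ p ∈ minimalPrimes R, ¬ maximalIdeal R ≤ p := by
    intro p hp hle
    have : p.IsPrime := hp.1.1
    have hpm : p = maximalIdeal R := le_antisymm (le_maximalIdeal this.ne_top) hle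
    have h0 : ringKrullDim R = 0 := by
      rw [← maximalIdeal_height_eq_ringKrullDim, ← hpm, Ideal.height_eq_zero_iff.2 hp]
      rfl
    have h1 := spanFinrank_maximalIdeal (R := R)
    rw [h0] at h1
    have h2 : (maximalIdeal R).spanFinrank = 0 := by exact_mod_cast h1
    exact hbot ((Submodule.spanFinrank_eq_zero_iff_eq_bot (IsNoetherian.noetherian _)).1 h2)
  have hsq : ¬ maximalIdeal R ≤ maximalIdeal R ^ 2 := by
    intro hle
    refine hbot (Submodule.eq_bot_of_le_smul_of_le_jacobson_bot (maximalIdeal R) _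
      (IsNoetherian.noetherian _) ?_ (maximalIdeal_le_jacobson _))
    simpa [pow_two] using hle
  -- Prime avoidance, which tolerates the one non-prime ideal `𝔪²`.
  obtain ⟨h, hm, hnot⟩ : ∃ h ∈ maximalIdeal R, h ∉ maximalIdeal R ^ 2 ∧
      ∀ p ∈ minimalPrimes R, h ∉ p := by
    by_contra! hcon
    have hfin : (minimalPrimes R).Finite := minimalPrimes.finite_of_isNoetherianRing R
    have hsub : ((maximalIdeal R : Ideal R) : Set R) ⊆
        ⋃ I ∈ (insert (maximalIdeal R ^ 2) (minimalPrimes R)), (I : Set R) := by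
      intro x hx
      by_cases hx2 : x ∈ maximalIdeal R ^ 2
      · exact Set.mem_biUnion (Set.mem_insert _ _) hx2
      · obtain ⟨p, hp, hxp⟩ := hcon x hx hx2
        exact Set.mem_biUnion (Set.mem_insert_of_mem _ hp) hxp
    obtain ⟨I, hI, hle⟩ := (Ideal.subset_union_prime_finite (hfin.insert (maximalIdeal R ^ 2))
      (f := id) (maximalIdeal R ^ 2) (maximalIdeal R ^ 2) (by
        intro I hI hne _
        exact (Set.mem_of_mem_insert_of_ne hI hne).1.1)).1 hsub
    rcases hI with rfl | hI
    · exact hsq hle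
    · exact hmin _ hI hle
  obtain ⟨hreg, hlt⟩ := quotient_span_singleton hm hnot.1
  have hdom := ih _ (hn ▸ hlt) (R ⧸ Ideal.span {h}) rfl
  have hprime : (Ideal.span {h}).IsPrime := (Ideal.Quotient.isDomain_iff_prime _).1 hdom
  obtain ⟨p, hp, hple⟩ := Ideal.exists_minimalPrimes_le (bot_le : ⊥ ≤ Ideal.span {h})
  have hpp : p.IsPrime := hp.1.1
  -- Since `p ⊆ (h)` and `h ∉ p`, one has `p = h p`, and Nakayama applies.
  have hp0 : p = ⊥ := by
    refine Submodule.eq_bot_of_le_smul_of_le_jacobson_bot (Ideal.span {h}) p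
      (IsNoetherian.noetherian _) ?_ ?_
    · intro y hy
      obtain ⟨z, rfl⟩ := Ideal.mem_span_singleton'.1 (hple hy)
      rw [mul_comm]
      exact Submodule.smul_mem_smul (Ideal.mem_span_singleton_self h)
        ((hpp.mem_or_mem hy).resolve_right (hnot.2 p hp))
    · refine le_trans ?_ (maximalIdeal_le_jacobson _)
      simpa [Ideal.span_le] using hm
  have : (⊥ : Ideal R).IsPrime := hp0 ▸ hpp
  exact IsDomain.of_bot_isPrime R

end IsRegularLocalRing

namespace IsRegularLocalRing

open IsLocalRing

/-- A one-dimensional regular local ring is a discrete valuation ring. -/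
theorem exists_isDiscreteValuationRing {B : Type*} [CommRing B] [IsRegularLocalRing B]
    (hdim : ringKrullDim B = 1) : ∃ _ : IsDomain B, IsDiscreteValuationRing B := by
  have := isDomain B
  refine ⟨this, ?_⟩
  have h1 : Module.finrank (ResidueField B) (CotangentSpace B) = 1 := by
    have := (iff_finrank_cotangentSpace B).1 inferInstance
    rw [hdim] at this
    exact_mod_cast this
  exact finrank_CotangentSpace_eq_one_iff.1 h1

/-- The ideal `(h)` is prime, because the quotient by it is regular, hence a domain. Were it
strictly inside `P`, it would have height zero, forcing `h = 0`. -/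
theorem eq_span_singleton_of_height_eq_one {A : Type*} [CommRing A] [IsRegularLocalRing A]
    {P : Ideal A} [P.IsPrime] (hP : P.height = 1) {h : A} (hh : h ∈ P)
    (h2 : h ∉ maximalIdeal A ^ 2) : P = Ideal.span {h} := by
  have := isDomain A
  obtain ⟨hreg, -⟩ := quotient_span_singleton (le_maximalIdeal (Ideal.IsPrime.ne_top ‹_›) hh) h2
  have : (Ideal.span {h}).IsPrime := (Ideal.Quotient.isDomain_iff_prime _).1 (isDomain _)
  have hle : Ideal.span {h} ≤ P := by simpa [Ideal.span_le] using hh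
  by_contra hne
  have hlt := Ideal.height_strict_mono_of_isPrime_of_isPrime (lt_of_le_of_ne hle (Ne.symm hne))
  rw [hP, Order.lt_one_iff, Ideal.height_eq_zero_iff, IsDomain.minimalPrimes_eq_singleton_bot,
    Set.mem_singleton_iff, Ideal.span_singleton_eq_bot] at hlt
  exact h2 (hlt ▸ zero_mem _)

end IsRegularLocalRing

/-! ### Lower bound for the order of a function along a transverse arc. -/

namespace PowerSeries

/-- If all linear coefficients vanished on `P`, the extended ideal would lie in `(X²)`, which does
not contain `X`. -/
theorem exists_coeff_one_ne_zero_of_map_eq_span_X {A k : Type*} [CommRing A] [Field k]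
    (ψ : A →+* PowerSeries k) {P : Ideal A} (h : P.map ψ = Ideal.span {X}) :
    ∃ a ∈ P, coeff 1 (ψ a) ≠ 0 := by
  by_contra! hcon
  have hle : P.map ψ ≤ Ideal.span {X ^ 2} := by
    rw [Ideal.map_le_iff_le_comap]
    intro a ha
    have h0 : X ∣ ψ a := Ideal.mem_span_singleton.1 (h ▸ Ideal.mem_map_of_mem ψ ha)
    rw [Ideal.mem_comap, Ideal.mem_span_singleton, X_pow_dvd_iff]
    intro m hm
    interval_cases m
    · rw [coeff_zero_eq_constantCoeff_apply]
      exact X_dvd_iff.1 h0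
    · exact hcon a ha
  have hX : (X : PowerSeries k) ∈ Ideal.span {X ^ 2} :=
    hle (h ▸ Ideal.mem_span_singleton_self _)
  have := X_pow_dvd_iff.1 (Ideal.mem_span_singleton.1 hX) 1 (by norm_num)
  simp at this

theorem X_dvd_map_of_mem_maximalIdeal {A k : Type*} [CommRing A] [IsLocalRing A] [Field k]
    (ψ : A →+* PowerSeries k) [IsLocalHom ψ] {a : A} (ha : a ∈ IsLocalRing.maximalIdeal A) :
    X ∣ ψ a := by
  rw [X_dvd_iff]
  by_contra hne
  exact ha (isUnit_of_map_unit ψ a (isUnit_iff_constantCoeff.2 (isUnit_iff_ne_zero.2 hne)))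

/-- An arc transverse to a prime divisor of a regular local ring vanishes along the divisor of `f`
to order at least the order of `f` at the generic point of the divisor. -/
theorem X_pow_dvd_map_of_le_ord {A B k : Type*} [CommRing A] [IsRegularLocalRing A] [CommRing B]
    [IsRegularLocalRing B] [Algebra A B] [Field k] (P : Ideal A) [P.IsPrime]
    [IsLocalization.AtPrime B P] (hdim : ringKrullDim B = 1) (ψ : A →+* PowerSeries k)
    [IsLocalHom ψ] (hψ : P.map ψ = Ideal.span {X}) {f : A} {n : ℕ}
    (hord : (n : ℕ∞) ≤ Ring.ord B (algebraMap A B f)) : X ^ n ∣ ψ f := by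
  obtain ⟨h, hhP, h1⟩ := exists_coeff_one_ne_zero_of_map_eq_span_X ψ hψ
  -- A local homomorphism sends `𝔪²` into `(X²)`, but `ψ h` has a nonzero linear term.
  have h2 : h ∉ IsLocalRing.maximalIdeal A ^ 2 := by
    intro hmem
    have hle : IsLocalRing.maximalIdeal A ^ 2 ≤ (Ideal.span {X ^ 2}).comap ψ := by
      rw [pow_two, Ideal.mul_le]
      intro a ha b hb
      rw [Ideal.mem_comap, Ideal.mem_span_singleton, map_mul, pow_two]
      exact mul_dvd_mul (X_dvd_map_of_mem_maximalIdeal ψ ha) (X_dvd_map_of_mem_maximalIdeal ψ hb)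
    exact h1 (X_pow_dvd_iff.1 (Ideal.mem_span_singleton.1 (hle hmem)) 1 (by norm_num))
  have hht : P.height = 1 := by
    have := IsLocalization.AtPrime.ringKrullDim_eq_height P B
    rw [hdim] at this
    exact_mod_cast this.symm
  have hP := IsRegularLocalRing.eq_span_singleton_of_height_eq_one hht hhP h2
  have := IsRegularLocalRing.isDomain A
  have h0 : h ≠ 0 := fun e => h2 (e ▸ zero_mem _)
  have hprime : Prime h := (Ideal.span_singleton_prime h0).1 (hP ▸ ‹P.IsPrime›)
  obtain ⟨_, _⟩ := IsRegularLocalRing.exists_isDiscreteValuationRing hdim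
  have hirr : Irreducible (algebraMap A B h) := by
    rw [IsDiscreteValuationRing.irreducible_iff_uniformizer,
      ← IsLocalization.AtPrime.map_eq_maximalIdeal P B, hP, Ideal.map_span, Set.image_singleton]
  have hdvd : algebraMap A B h ^ n ∣ algebraMap A B f := by
    rw [← IsDiscreteValuationRing.addVal_le_iff_dvd, AddValuation.map_pow,
      IsDiscreteValuationRing.addVal_uniformizer hirr, ← Ring.ord_eq_addVal]
    simpa using hord
  obtain ⟨c, hc⟩ := hdvd
  obtain ⟨⟨c', s⟩, hs⟩ := IsLocalization.surj P.primeCompl c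
  have heq : (s : A) * f = h ^ n * c' := by
    refine IsLocalization.injective B P.primeCompl_le_nonZeroDivisors ?_
    simp only [map_mul, map_pow]
    rw [← hs, hc]
    ring
  -- The denominator `s` lies outside `P = (h)`, so the prime `h` cannot divide it, and divisibility
  -- descends from `B` to `A`.
  have hf : h ^ n ∣ f := by
    refine hprime.pow_dvd_of_dvd_mul_left n (a := (s : A)) ?_ ⟨c', heq⟩
    intro hd
    exact s.2 (hP.ge (Ideal.mem_span_singleton.2 hd))
  have hX : X ∣ ψ h := Ideal.mem_span_singleton.1 (hψ ▸ Ideal.mem_map_of_mem ψ hhP)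
  exact (pow_dvd_pow_of_dvd hX n).trans (by simpa using map_dvd ψ hf)

end PowerSeries

/-! ### Expansion in powers of a parameter, and formal arcs. -/

namespace PowerSeries

open IsLocalRing

/-- `F` is a power series expansion of `a` in powers of `h`. -/
def IsExpansion {k A : Type*} [Field k] [CommRing A] [Algebra k A] (h a : A)
    (F : PowerSeries k) : Prop :=
  ∀ n : ℕ, ∃ p : Polynomial k, X ^ n ∣ F - (p : PowerSeries k) ∧ h ^ n ∣ a - Polynomial.aeval h p

namespace IsExpansion

variable {k A : Type*} [Field k] [CommRing A] [Algebra k A] {h a b : A} {F G : PowerSeries k}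

theorem add (ha : IsExpansion h a F) (hb : IsExpansion h b G) : IsExpansion h (a + b) (F + G) := by
  intro n
  obtain ⟨p, hp, hp'⟩ := ha n
  obtain ⟨q, hq, hq'⟩ := hb n
  refine ⟨p + q, ?_, ?_⟩
  · have : F + G - ((p + q : Polynomial k) : PowerSeries k) = (F - p) + (G - q) := by
      push_cast; ring
    exact this ▸ dvd_add hp hq
  · have : a + b - Polynomial.aeval h (p + q) =
        (a - Polynomial.aeval h p) + (b - Polynomial.aeval h q) := by
      rw [map_add]; ring
    exact this ▸ dvd_add hp' hq'

theorem mul (ha : IsExpansion h a F) (hb : IsExpansion h b G) : IsExpansion h (a * b) (F * G) := by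
  intro n
  obtain ⟨p, hp, hp'⟩ := ha n
  obtain ⟨q, hq, hq'⟩ := hb n
  refine ⟨p * q, ?_, ?_⟩
  · have : F * G - ((p * q : Polynomial k) : PowerSeries k) = (F - p) * G + p * (G - q) := by
      push_cast; ring
    exact this ▸ dvd_add (hp.mul_right _) (hq.mul_left _)
  · have : a * b - Polynomial.aeval h (p * q) =
        (a - Polynomial.aeval h p) * b + Polynomial.aeval h p * (b - Polynomial.aeval h q) := by
      rw [map_mul]; ring
    exact this ▸ dvd_add (hp'.mul_right _) (hq'.mul_left _)

theorem const (c : k) : IsExpansion h (algebraMap k A c) (C c) :=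
  fun n => ⟨Polynomial.C c, by simp, by simp⟩

theorem self : IsExpansion h h (X : PowerSeries k) :=
  fun n => ⟨Polynomial.X, by simp, by simp⟩

variable [IsLocalRing A]

/-- A nonzero `F` of order `c` would make `h^c` times a unit vanish. No separatedness of `A` is
needed: non-nilpotency of `h` suffices. -/
theorem eq_zero (hm : h ∈ maximalIdeal A) (hnil : ¬ IsNilpotent h) (hF : IsExpansion h 0 F) :
    F = 0 := by
  by_contra hne
  obtain ⟨c, hc⟩ := ENat.ne_top_iff_exists.1 (order_eq_top.not.2 hne)
  have hcoeff : coeff c F ≠ 0 := by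
    have := coeff_order hne
    simpa [← hc] using this
  have hlow : ∀ i < c, coeff i F = 0 := fun i hi =>
    coeff_of_lt_order i (by rw [← hc]; exact_mod_cast hi)
  -- Precision `c + 1` is the least that sees the leading coefficient.
  obtain ⟨p, hp, hp'⟩ := hF (c + 1)
  have hpF : ∀ i < c + 1, p.coeff i = coeff i F := by
    intro i hi
    have := X_pow_dvd_iff.1 hp i hi
    rw [map_sub, Polynomial.coeff_coe, sub_eq_zero] at this
    exact this.symm
  obtain ⟨q, rfl⟩ : Polynomial.X ^ c ∣ p := by
    rw [Polynomial.X_pow_dvd_iff]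
    intro i hi
    rw [hpF i (by lia), hlow i hi]
  have hq0 : q.coeff 0 ≠ 0 := by
    have := hpF c (by lia)
    rw [Polynomial.coeff_X_pow_mul', if_pos le_rfl, Nat.sub_self] at this
    rwa [this]
  obtain ⟨r, hr⟩ : h ∣ Polynomial.aeval h q - algebraMap k A (q.coeff 0) := by
    obtain ⟨r, hr⟩ := Polynomial.X_dvd_sub_C (p := q)
    exact ⟨Polynomial.aeval h r, by simpa using congrArg (Polynomial.aeval h) hr⟩
  obtain ⟨d, hd⟩ := hp'
  have hu : IsUnit (algebraMap k A (q.coeff 0) + h * (r + d)) := by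
    by_contra hnu
    have h1 : algebraMap k A (q.coeff 0) ∈ maximalIdeal A := by
      have := (maximalIdeal A).sub_mem ((mem_maximalIdeal _).2 hnu)
        ((maximalIdeal A).mul_mem_right (r + d) hm)
      simpa using this
    exact h1 ((isUnit_iff_ne_zero.2 hq0).map _)
  refine hnil ⟨c, hu.mul_left_eq_zero.1 ?_⟩
  simp only [map_mul, map_pow, Polynomial.aeval_X] at hd
  linear_combination -hd - h ^ c * hr

theorem unique (hm : h ∈ maximalIdeal A) (hnil : ¬ IsNilpotent h) (hF : IsExpansion h a F)
    (hG : IsExpansion h a G) : F = G := by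
  have h1 : IsExpansion h (a + algebraMap k A (-1) * a) (F + C (-1) * G) :=
    hF.add ((const (-1)).mul hG)
  have h2 := eq_zero (F := F + C (-1) * G) hm hnil (by simpa using h1)
  rw [map_neg, map_one] at h2
  linear_combination h2

/-- Write `a = c + h b` with `c` the residue of `a`, and repeat with `b`; the successive residues
are the coefficients. -/
theorem exists_isExpansion (hm : maximalIdeal A = Ideal.span {h})
    (hres : ∀ a : A, ∃ c : k, a - algebraMap k A c ∈ maximalIdeal A) (a : A) :
    ∃ F : PowerSeries k, IsExpansion h a F := by
  have hstep : ∀ a : A, ∃ (c : k) (b : A), a = algebraMap k A c + h * b := by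
    intro a
    obtain ⟨c, hc⟩ := hres a
    rw [hm] at hc
    obtain ⟨b, hb⟩ := Ideal.mem_span_singleton.1 hc
    exact ⟨c, b, by linear_combination hb⟩
  choose c next hnext using hstep
  let F : PowerSeries k := PowerSeries.mk fun n => c (next^[n] a)
  have key : ∀ n, a = Polynomial.aeval h (trunc n F) + h ^ n * next^[n] a := by
    intro n
    induction n with
    | zero => simp
    | succ n ih =>
      rw [trunc_succ, map_add, Polynomial.aeval_monomial, Function.iterate_succ_apply']
      have := hnext (next^[n] a)
      have hF : coeff n F = c (next^[n] a) := coeff_mk _ _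
      rw [hF]
      linear_combination ih + h ^ n * this
  refine ⟨F, fun n => ⟨trunc n F, ?_, next^[n] a, ?_⟩⟩
  · rw [X_pow_dvd_iff]
    intro i hi
    simp [coeff_trunc, hi]
  · linear_combination key n

end IsExpansion

/-- A local `k`-algebra with residue field `k` and principal maximal ideal `(h)`, with `h` not
nilpotent, maps to `k⟦X⟧` by expansion in powers of `h`. -/
theorem exists_algHom_of_maximalIdeal_eq_span {k A : Type*} [Field k] [CommRing A] [Algebra k A]
    [IsLocalRing A] {h : A} (hm : maximalIdeal A = Ideal.span {h}) (hnil : ¬ IsNilpotent h)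
    (hres : ∀ a : A, ∃ c : k, a - algebraMap k A c ∈ maximalIdeal A) :
    ∃ φ : A →ₐ[k] PowerSeries k, φ h = X := by
  -- Uniqueness of expansions makes this choice compatible with sums, products and constants.
  choose φ hφ using IsExpansion.exists_isExpansion hm hres
  have hmem : h ∈ maximalIdeal A := hm ▸ Ideal.mem_span_singleton_self h
  have huniq {a F} (hF : IsExpansion h a F) : φ a = F := (hφ a).unique hmem hnil hF
  have halg (c : k) : φ (algebraMap k A c) = C c := huniq (.const c)
  exact ⟨{ toFun := φ
           map_one' := by simpa using halg 1
           map_zero' := by simpa using halg 0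
           map_mul' := fun a b => huniq ((hφ a).mul (hφ b))
           map_add' := fun a b => huniq ((hφ a).add (hφ b))
           commutes' := halg }, huniq .self⟩

/-- On a regular local `k`-algebra with residue field `k`, every element of `𝔪 ∖ 𝔪²` becomes the
parameter of a formal arc. -/
theorem exists_algHom_of_isRegularLocalRing {k A : Type*} [Field k] [CommRing A] [Algebra k A]
    [IsRegularLocalRing A] {h : A} (hm : h ∈ maximalIdeal A) (h2 : h ∉ maximalIdeal A ^ 2)
    (hres : ∀ a : A, ∃ c : k, a - algebraMap k A c ∈ maximalIdeal A) :
    ∃ φ : A →ₐ[k] PowerSeries k, φ h = X := by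
  classical
  obtain ⟨s, hs, hspan⟩ := exists_finset_span_insert_eq_maximalIdeal hm h2
  have hle : Ideal.span (s : Set A) ≤ maximalIdeal A :=
    hspan ▸ Ideal.span_mono (Set.subset_insert _ _)
  set J : Ideal A := Ideal.span (s : Set A) with hJ
  have hJtop : J ≠ ⊤ := ne_top_of_le_ne_top (Ideal.IsPrime.ne_top inferInstance) hle
  have : Nontrivial (A ⧸ J) := Ideal.Quotient.nontrivial_iff.2 hJtop
  have : IsLocalRing (A ⧸ J) :=
    IsLocalRing.of_surjective' (Ideal.Quotient.mk _) Ideal.Quotient.mk_surjective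
  have hmap : (maximalIdeal A).map (Ideal.Quotient.mk J) = maximalIdeal (A ⧸ J) :=
    map_maximalIdeal_of_surjective _ Ideal.Quotient.mk_surjective
  have hmax : maximalIdeal (A ⧸ J) = Ideal.span {Ideal.Quotient.mk J h} := by
    rw [← hmap, ← hspan, ← Set.singleton_union, Ideal.span_union, Ideal.map_sup, ← hJ,
      Ideal.map_quotient_self, sup_bot_eq, Ideal.map_span, Set.image_singleton]
  -- Otherwise every minimal prime over `J` contains `h`, hence `𝔪`. Then `𝔪` has height at most the
  -- number of generators of `J`, which is less than the dimension.
  have hnil : ¬ IsNilpotent (Ideal.Quotient.mk J h) := by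
    rintro ⟨n, hn⟩
    rw [← map_pow, Ideal.Quotient.eq_zero_iff_mem] at hn
    have hheight : (maximalIdeal A).height ≤ J.height := by
      rw [J.height_eq_inf_minimalPrimes]
      refine le_iInf₂ fun p hp => ?_
      have hpp : p.IsPrime := hp.1.1
      refine Ideal.height_mono ?_
      rw [← hspan, Ideal.span_le]
      exact Set.insert_subset (hpp.mem_of_pow_mem n (hp.1.2 hn))
        (Ideal.subset_span.trans hp.1.2)
    have h1 := hheight.trans (J.height_le_spanFinrank hJtop)
    have h3 : J.spanFinrank ≤ s.card := by
      have := Submodule.spanFinrank_span_le_ncard_of_finite (R := A) s.finite_toSet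
      rwa [Set.ncard_coe_finset] at this
    have h4 : ((maximalIdeal A).spanFinrank : WithBot ℕ∞) = (maximalIdeal A).height := by
      rw [maximalIdeal_height_eq_ringKrullDim, IsRegularLocalRing.spanFinrank_maximalIdeal]
    have h5 : ((maximalIdeal A).spanFinrank : ℕ∞) = (maximalIdeal A).height := by
      exact_mod_cast h4
    rw [← h5] at h1
    have h6 : (maximalIdeal A).spanFinrank ≤ J.spanFinrank := by exact_mod_cast h1
    lia
  obtain ⟨φ, hφ⟩ := exists_algHom_of_maximalIdeal_eq_span (k := k) hmax hnil (by
    intro a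
    obtain ⟨a, rfl⟩ := Ideal.Quotient.mk_surjective a
    obtain ⟨c, hc⟩ := hres a
    refine ⟨c, ?_⟩
    have := Ideal.mem_map_of_mem (Ideal.Quotient.mk J) hc
    rwa [hmap, map_sub] at this)
  exact ⟨φ.comp (Ideal.Quotient.mkₐ k J), hφ⟩

/-- A `k`-algebra homomorphism from a local `k`-algebra to `k⟦X⟧` is local. -/
theorem X_dvd_algHom_of_mem_maximalIdeal {k A : Type*} [Field k] [CommRing A] [Algebra k A]
    [IsLocalRing A] (φ : A →ₐ[k] PowerSeries k) {a : A} (ha : a ∈ maximalIdeal A) : X ∣ φ a := by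
  rw [X_dvd_iff]
  set c := constantCoeff (φ a) with hc
  by_contra hne
  have hn : ¬ IsUnit (a - algebraMap k A c) := by
    intro hu
    have h1 := (hu.map φ).map (constantCoeff (R := k))
    simp [← hc] at h1
  have h1 : algebraMap k A c ∈ maximalIdeal A := by
    have := (maximalIdeal A).sub_mem ha ((mem_maximalIdeal _).2 hn)
    simpa using this
  exact h1 ((isUnit_iff_ne_zero.2 hne).map _)

end PowerSeries

/-! ### Generic transversality, and arcs on regular affine varieties. -/

open IsLocalRing in
/-- Generic transversality over a perfect field: if `h` generates the maximal ideal of the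
localization of a finitely generated algebra at the prime `P`, but not its square, then `h` lies
outside the square of the maximal ideal at the points of a dense open subset of `V(P)`. -/
theorem Algebra.FiniteType.exists_forall_mul_notMem_sq {k R : Type*} [Field k] [PerfectField k]
    [CommRing R] [Algebra k R] [Algebra.FiniteType k R] (P : Ideal R) [P.IsPrime] {h : R}
    (hh : maximalIdeal (Localization.AtPrime P) =
      Ideal.span {algebraMap R (Localization.AtPrime P) h})
    (h2 : algebraMap R (Localization.AtPrime P) h ∉ maximalIdeal (Localization.AtPrime P) ^ 2) :
    ∃ b ∉ P, ∀ Q : Ideal R, Q.IsPrime → P ≤ Q → b ∉ Q → ∀ s ∉ Q, s * h ∉ Q ^ 2 := by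
  classical
  let B := Localization.AtPrime P
  let κ := ResidueField B
  have : Algebra.EssFiniteType k B := .comp _ R _
  have : Algebra.EssFiniteType k κ := .comp _ B _
  let C := B ⧸ maximalIdeal B ^ 2
  let mk : B →ₐ[k] C := Ideal.Quotient.mkₐ k _
  have hmk : Function.Surjective mk := Ideal.Quotient.mk_surjective
  have hmk0 (y : B) : mk y = 0 ↔ y ∈ maximalIdeal B ^ 2 := Ideal.Quotient.eq_zero_iff_mem
  let π : B →ₐ[k] κ := IsScalarTower.toAlgHom k B κ
  have hπ : Function.Surjective π := IsLocalRing.residue_surjective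
  have hπ0 (y : B) : π y = 0 ↔ y ∈ maximalIdeal B := IsLocalRing.residue_eq_zero_iff y
  let g : C →ₐ[k] κ := Ideal.Quotient.liftₐ _ π
    (fun y hy => (hπ0 y).2 (Ideal.pow_le_self two_ne_zero hy))
  have hg (y : B) : g (mk y) = π y := rfl
  let ι : R →ₐ[k] B := IsScalarTower.toAlgHom k R B
  let q : R →ₐ[k] C := mk.comp ι
  let ρ : R →ₐ[k] κ := π.comp ι
  have hgq (r : R) : g (q r) = ρ r := rfl
  have hρ (r : R) : ρ r = 0 ↔ r ∈ P :=
    (hπ0 _).trans (IsLocalization.AtPrime.to_map_mem_maximal_iff B P r)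
  have hιh : ι h ∈ maximalIdeal B := hh ▸ Ideal.mem_span_singleton_self _
  have hkerg (c : C) (hc : g c = 0) : ∃ z : B, c = q h * mk z := by
    obtain ⟨y, rfl⟩ := hmk c
    rw [hg, hπ0, hh] at hc
    obtain ⟨z, rfl⟩ := Ideal.mem_span_singleton.1 hc
    exact ⟨z, map_mul mk _ _⟩
  have hϖ2 : q h * q h = 0 := by
    rw [← map_mul, ← pow_two]
    refine (hmk0 _).2 ?_
    rw [map_pow]
    exact Ideal.pow_mem_pow hιh 2
  have hann (c : C) (hc : g c = 0) : q h * c = 0 := by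
    obtain ⟨z, rfl⟩ := hkerg c hc
    rw [← mul_assoc, hϖ2, zero_mul]
  have hnil : IsNilpotent (RingHom.ker (g : C →+* κ)) := by
    refine ⟨2, (pow_two (RingHom.ker (g : C →+* κ))).trans (eq_bot_iff.2 (Ideal.mul_le.2 fun x hx y hy => ?_))⟩
    obtain ⟨z, rfl⟩ := hkerg x hx
    rw [mul_right_comm, hann y hy, zero_mul]
    exact zero_mem _
  have hgs : Function.Surjective g := fun d => by
    obtain ⟨y, rfl⟩ := hπ d
    exact ⟨mk y, rfl⟩
  -- A coefficient field in `B/𝔪²`: since `k` is perfect, `κ` is formally smooth over `k`, so the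
  -- identity lifts along the square-zero extension `g`.
  let σ : κ →ₐ[k] C := Algebra.FormallySmooth.liftOfSurjective (AlgHom.id k κ) g hgs hnil
  have hσ (d : κ) : g (σ d) = d :=
    Algebra.FormallySmooth.liftOfSurjective_apply (AlgHom.id k κ) g hgs hnil d
  have hϖσ (r : R) : q h * q r = q h * σ (ρ r) := by
    have := hann (q r - σ (ρ r)) (by rw [map_sub, hgq, hσ, sub_self])
    rwa [mul_sub, sub_eq_zero] at this
  have hϖinj (d : κ) (hd : q h * σ d = 0) : d = 0 := by
    by_contra hne
    have := ((isUnit_iff_ne_zero.2 hne).map σ).mul_left_eq_zero.1 hd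
    exact h2 ((hmk0 _).1 this)
  -- Writing `q r = σ (ρ r) + q h * σ d` defines a derivation `r ↦ d` from `R` to `κ`, with value
  -- `1` at `h`.
  have hdiff (r : R) : ∃ d : κ, q r - σ (ρ r) = q h * σ d := by
    obtain ⟨z, hz⟩ := hkerg (q r - σ (ρ r)) (by rw [map_sub, hgq, hσ, sub_self])
    refine ⟨π z, ?_⟩
    have := hann (mk z - σ (π z)) (by rw [map_sub, hg, hσ, sub_self])
    rw [mul_sub, sub_eq_zero] at this
    rw [hz, this]
  have hfrac (d : κ) : ∃ n s : R, s ∉ P ∧ d * ρ s = ρ n := by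
    obtain ⟨z, rfl⟩ := hπ d
    obtain ⟨⟨n, s⟩, hs⟩ := IsLocalization.surj P.primeCompl z
    refine ⟨n, s, s.2, ?_⟩
    exact (map_mul π _ _).symm.trans (congrArg π hs)
  choose d hd using hdiff
  choose n s hsP hns using fun r => hfrac (d r)
  obtain ⟨S, hS⟩ := (‹Algebra.FiniteType k R›).out
  -- A common denominator for the derivation on the algebra generators, hence on all of `R`.
  let b : R := ∏ r ∈ S, s r
  have hb : b ∉ P := fun hmem => by
    obtain ⟨r, -, hr⟩ := (Ideal.IsPrime.prod_mem_iff).1 hmem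
    exact hsP r hr
  -- That is, `c` represents `b` times the derivative of `r` modulo `P`. The next facts are
  -- additivity, the Leibniz rule and uniqueness modulo `P`.
  let E (r c : R) : Prop := σ (ρ b) * (q r - σ (ρ r)) = q h * σ (ρ c)
  have hEadd {r c r' c' : R} (h1 : E r c) (h1' : E r' c') : E (r + r') (c + c') := by
    simp only [E, map_add] at *
    linear_combination h1 + h1'
  have hEmul {r c r' c' : R} (h1 : E r c) (h1' : E r' c') :
      E (r * r') (r * c' + c * r') := by
    simp only [E, map_add, map_mul] at *
    linear_combination q r * h1' + σ (ρ r') * h1 + σ (ρ c') * hϖσ r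
  have hEuniq {r c c' : R} (h1 : E r c) (h1' : E r c') : c - c' ∈ P := by
    rw [← hρ]
    refine hϖinj _ ?_
    simp only [E, map_sub] at *
    linear_combination h1' - h1
  have hEh : E h b := by
    have h0 : ρ h = 0 := (hπ0 _).2 hιh
    simp only [E, h0, map_zero]
    ring
  let T : Subalgebra k R :=
    { carrier := {r | ∃ c, E r c}
      mul_mem' := fun ⟨_, h1⟩ ⟨_, h1'⟩ => ⟨_, hEmul h1 h1'⟩
      add_mem' := fun ⟨_, h1⟩ ⟨_, h1'⟩ => ⟨_, hEadd h1 h1'⟩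
      algebraMap_mem' := fun c => ⟨0, by simp [E]⟩ }
  have hT : T = ⊤ := by
    refine top_le_iff.1 (hS.ge.trans (Algebra.adjoin_le fun r hr => ?_))
    refine ⟨(∏ r' ∈ S.erase r, s r') * n r, ?_⟩
    have hbr : b = s r * ∏ r' ∈ S.erase r, s r' := (Finset.mul_prod_erase S s hr).symm
    have h1 := congrArg σ (hns r)
    simp only [E, hd, hbr, map_mul] at *
    linear_combination q h * σ (ρ (∏ r' ∈ S.erase r, s r')) * h1
  have hE (r : R) : ∃ c, E r c := (hT ▸ Algebra.mem_top : r ∈ T)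
  refine ⟨b, hb, fun Q hQ hPQ hbQ t ht hmem => ?_⟩
  -- By Leibniz, the derivative of an element of `Q²` is represented in `Q`. For `t * h` it is `t *
  -- b` modulo `Q`, so `t * h ∈ Q²` would put `t` or `b` in `Q`.
  have hsq : ∀ y ∈ Q ^ 2, ∃ c ∈ Q, E y c := by
    intro y hy
    rw [pow_two] at hy
    refine Submodule.mul_induction_on hy ?_ ?_
    · intro r hr r' hr'
      obtain ⟨c, hc⟩ := hE r
      obtain ⟨c', hc'⟩ := hE r'
      exact ⟨_, Q.add_mem (Q.mul_mem_right _ hr) (Q.mul_mem_left _ hr'), hEmul hc hc'⟩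
    · rintro x y ⟨c, hcQ, hc⟩ ⟨c', hcQ', hc'⟩
      exact ⟨_, Q.add_mem hcQ hcQ', hEadd hc hc'⟩
  obtain ⟨c, hcQ, hc⟩ := hsq _ hmem
  obtain ⟨c', hc'⟩ := hE t
  have h1 := hPQ (hEuniq (hEmul hc' hEh) hc)
  have hhQ : h ∈ Q := hPQ ((IsLocalization.AtPrime.to_map_mem_maximal_iff B P h).1 hιh)
  have h3 : t * b ∈ Q := by
    have := Q.sub_mem (Q.add_mem h1 hcQ) (Q.mul_mem_left c' hhQ)
    convert this using 1
    ring
  exact (hQ.mem_or_mem h3).elim ht hbQ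

/-- Nullstellensatz: a prime of a finitely generated algebra is the intersection of the maximal
ideals that contain it. -/
theorem Algebra.FiniteType.exists_isMaximal_notMem {k R : Type*} [Field k] [CommRing R]
    [Algebra k R] [Algebra.FiniteType k R] (P : Ideal R) [hP : P.IsPrime] {g : R} (hg : g ∉ P) :
    ∃ Q : Ideal R, Q.IsMaximal ∧ P ≤ Q ∧ g ∉ Q := by
  have : IsJacobsonRing R := isJacobsonRing_of_finiteType (A := k)
  have h1 : g ∉ P.jacobson := by rwa [IsJacobsonRing.out ‹_› hP.isRadical]
  rw [Ideal.jacobson, Ideal.mem_sInf] at h1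
  push Not at h1
  obtain ⟨Q, ⟨hPQ, hQ⟩, hgQ⟩ := h1
  exact ⟨Q, hQ, hPQ, hgQ⟩

/-- By the Nullstellensatz `R/Q` is finite over the algebraically closed field `k`, hence equal to
it. -/
theorem Algebra.FiniteType.exists_sub_algebraMap_mem {k R : Type*} [Field k] [IsAlgClosed k]
    [CommRing R] [Algebra k R] [Algebra.FiniteType k R] (Q : Ideal R) [Q.IsMaximal] (r : R) :
    ∃ c : k, r - algebraMap k R c ∈ Q := by
  let : Field (R ⧸ Q) := Ideal.Quotient.field Q
  have : Module.Finite k (R ⧸ Q) := finite_of_finite_type_of_isJacobsonRing k (R ⧸ Q)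
  obtain ⟨c, hc⟩ := (IsAlgClosed.algebraMap_bijective_of_isIntegral (k := k) (K := R ⧸ Q)).2
    (Ideal.Quotient.mk Q r)
  refine ⟨c, Ideal.Quotient.eq_zero_iff_mem.1 ?_⟩
  rw [map_sub, ← hc]
  exact sub_self _

open IsLocalRing in
/-- On a regular affine variety there is an arc transverse to a given prime divisor along which a
given function vanishes to exactly its order along the divisor. -/
theorem Algebra.FiniteType.exists_algHom_powerSeries {k R : Type*} [Field k] [IsAlgClosed k]
    [CommRing R] [Algebra k R] [Algebra.FiniteType k R] (P : Ideal R) [P.IsPrime]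
    (hreg : ∀ (Q : Ideal R) [Q.IsPrime], IsRegularLocalRing (Localization.AtPrime Q))
    (B : Type*) [CommRing B] [Algebra R B] [IsLocalization.AtPrime B P]
    (hdim : ringKrullDim B = 1) {f : R} {n : ℕ} (hf : Ring.ord B (algebraMap R B f) = n) :
    ∃ φ : R →ₐ[k] PowerSeries k, (∀ a ∈ P, PowerSeries.X ∣ φ a) ∧ (∃ h ∈ P, φ h = PowerSeries.X) ∧
      PowerSeries.coeff n (φ f) ≠ 0 := by
  let L := Localization.AtPrime P
  let e : L ≃ₐ[R] B := IsLocalization.algEquiv P.primeCompl L B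
  have := hreg P
  have : IsRegularLocalRing B := .of_ringEquiv e.toRingEquiv
  obtain ⟨_, _⟩ := IsRegularLocalRing.exists_isDiscreteValuationRing hdim
  obtain ⟨_, _⟩ := IsRegularLocalRing.exists_isDiscreteValuationRing (B := L)
    ((ringKrullDim_eq_of_ringEquiv e.toRingEquiv).trans hdim)
  obtain ⟨ϖ, hϖ⟩ := IsDiscreteValuationRing.exists_irreducible B
  -- The numerator of a uniformizer is again a uniformizer, and it lives in `R`.
  obtain ⟨⟨h, s₀⟩, hs₀⟩ := IsLocalization.surj P.primeCompl ϖ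
  have hirr : Irreducible (algebraMap R B h) := by
    have hu : IsUnit (algebraMap R B s₀) := IsLocalization.map_units B s₀
    have hassoc : Associated ϖ (algebraMap R B h) := ⟨hu.unit, hs₀⟩
    exact hassoc.irreducible hϖ
  have hirrL : Irreducible (algebraMap R L h) := by
    rwa [← MulEquiv.irreducible_iff e, e.commutes]
  have hmax : maximalIdeal L = Ideal.span {algebraMap R L h} :=
    (IsDiscreteValuationRing.irreducible_iff_uniformizer _).1 hirrL
  have hmax2 : algebraMap R L h ∉ maximalIdeal L ^ 2 := by
    rw [hmax, Ideal.span_singleton_pow, Ideal.mem_span_singleton]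
    intro hdvd
    have := IsDiscreteValuationRing.addVal_le_iff_dvd.2 hdvd
    rw [AddValuation.map_pow, IsDiscreteValuationRing.addVal_uniformizer hirrL] at this
    exact absurd this (by decide)
  have hhP : h ∈ P := (IsLocalization.AtPrime.to_map_mem_maximal_iff L P h).1
    (hmax ▸ Ideal.mem_span_singleton_self _)
  obtain ⟨b, hb, hbQ⟩ := exists_forall_mul_notMem_sq (k := k) P hmax hmax2
  obtain ⟨s, hs, u, hu, hsu⟩ : ∃ s ∉ P, ∃ u ∉ P, s * f = u * h ^ n := by
    have hassoc : Associated (algebraMap R B h ^ n) (algebraMap R B f) := by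
      rw [← IsDiscreteValuationRing.addVal_eq_iff_associated, AddValuation.map_pow,
        IsDiscreteValuationRing.addVal_uniformizer hirr, ← Ring.ord_eq_addVal, hf]
      simp
    obtain ⟨v, hv⟩ := hassoc
    obtain ⟨⟨w, t⟩, hwt⟩ := IsLocalization.surj P.primeCompl (v : B)
    have hw : w ∉ P := by
      have : IsUnit (algebraMap R B w) := hwt ▸ v.isUnit.mul (IsLocalization.map_units B t)
      exact (IsLocalization.AtPrime.isUnit_to_map_iff B P w).1 this
    obtain ⟨e, he⟩ := (IsLocalization.eq_iff_exists P.primeCompl B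
      (x := (t : R) * f) (y := w * h ^ n)).1 (by
        simp only [map_mul, map_pow]
        rw [← hv, ← hwt]
        ring)
    exact ⟨e * t, (e * t).2, e * w, P.primeCompl.mul_mem e.2 hw, by linear_combination he⟩
  -- At a closed point of `V(P)` where `b`, `s` and `u` do not vanish, `h` is outside `𝔪²` and `f`
  -- is a unit times `h^n`.
  obtain ⟨Q, hQ, hPQ, hgQ⟩ := exists_isMaximal_notMem (k := k) P (g := b * s * u)
    (P.primeCompl.mul_mem (P.primeCompl.mul_mem hb hs) hu)
  have hbQ' : b ∉ Q := fun hm => hgQ (Q.mul_mem_right _ (Q.mul_mem_right _ hm))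
  have hsQ : s ∉ Q := fun hm => hgQ (Q.mul_mem_right _ (Q.mul_mem_left _ hm))
  have huQ : u ∉ Q := fun hm => hgQ (Q.mul_mem_left _ hm)
  let A := Localization.AtPrime Q
  have hregQ : IsRegularLocalRing A := hreg Q
  have hmapQ : Q.map (algebraMap R A) = maximalIdeal A := Localization.AtPrime.map_eq_maximalIdeal
  have hm : algebraMap R A h ∈ maximalIdeal A := hmapQ ▸ Ideal.mem_map_of_mem _ (hPQ hhP)
  have hm2 : algebraMap R A h ∉ maximalIdeal A ^ 2 := by
    rw [← hmapQ, ← Ideal.map_pow, IsLocalization.mem_map_algebraMap_iff Q.primeCompl]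
    rintro ⟨⟨y, t⟩, hyt⟩
    rw [← map_mul] at hyt
    obtain ⟨e, he⟩ := (IsLocalization.eq_iff_exists Q.primeCompl A).1 hyt
    refine hbQ Q hQ.isPrime hPQ hbQ' (e * t) (e * t).2 ?_
    have : (e : R) * t * h = e * y := by linear_combination he
    exact this ▸ Ideal.mul_mem_left _ _ y.2
  have hres (a : A) : ∃ c : k, a - algebraMap k A c ∈ maximalIdeal A := by
    obtain ⟨r', hr'⟩ := (IsLocalization.AtPrime.equivQuotMaximalIdeal Q A).surjective
      (Ideal.Quotient.mk _ a)
    obtain ⟨r, rfl⟩ := Ideal.Quotient.mk_surjective r'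
    obtain ⟨c, hc⟩ := exists_sub_algebraMap_mem (k := k) Q r
    have h1 : algebraMap R A r - a ∈ maximalIdeal A := Ideal.Quotient.eq.1 hr'
    have h3 : algebraMap R A (r - algebraMap k R c) ∈ maximalIdeal A :=
      hmapQ ▸ Ideal.mem_map_of_mem _ hc
    refine ⟨c, ?_⟩
    rw [map_sub, ← IsScalarTower.algebraMap_apply] at h3
    have := (maximalIdeal A).sub_mem h3 h1
    convert this using 1
    ring
  obtain ⟨φ, hφ⟩ := PowerSeries.exists_algHom_of_isRegularLocalRing hm hm2 hres
  let ψ : R →ₐ[k] PowerSeries k := φ.comp (IsScalarTower.toAlgHom k R A)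
  have hψh : ψ h = PowerSeries.X := hφ
  have hunit (r : R) (hr : r ∉ Q) : IsUnit (ψ r) :=
    (IsLocalization.map_units A (⟨r, hr⟩ : Q.primeCompl)).map φ
  refine ⟨ψ, fun a ha => ?_, ⟨h, hhP, hψh⟩, ?_⟩
  · exact PowerSeries.X_dvd_algHom_of_mem_maximalIdeal φ
      (hmapQ ▸ Ideal.mem_map_of_mem _ (hPQ ha))
  · intro hcoeff
    have heq : ψ s * ψ f = ψ u * PowerSeries.X ^ n := by
      rw [← hψh, ← map_mul, hsu, map_mul, map_pow]
    have hd1 : PowerSeries.X ^ n ∣ ψ f :=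
      (hunit s hsQ).dvd_mul_left.1 (heq ▸ dvd_mul_left _ _)
    have hd2 : PowerSeries.X ^ (n + 1) ∣ ψ f := by
      rw [PowerSeries.X_pow_dvd_iff] at hd1 ⊢
      intro m hm
      rcases Nat.lt_succ_iff_lt_or_eq.1 hm with hm | rfl
      · exact hd1 m hm
      · exact hcoeff
    have hd3 : PowerSeries.X ^ (n + 1) ∣ (PowerSeries.X ^ n : PowerSeries k) :=
      (hunit u huQ).dvd_mul_left.1 (heq ▸ hd2.mul_left _)
    have := PowerSeries.X_pow_dvd_iff.1 hd3 n (Nat.lt_succ_self n)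
    simp [PowerSeries.coeff_X_pow] at this

/-! ### Stalks, specialization and affine charts. -/

namespace AlgebraicGeometry

open IsLocalRing

/-- The stalk at a generization of `x` is a localization of the stalk at `x`. -/
theorem Scheme.isLocalization_stalkSpecializes {X : Scheme.{u}} {x y : X} (h : y ⤳ x) :
    letI := (X.presheaf.stalkSpecializes h).hom.toAlgebra
    IsLocalization.AtPrime (X.presheaf.stalk y)
      ((maximalIdeal (X.presheaf.stalk y)).comap (X.presheaf.stalkSpecializes h).hom) := by
  let := (X.presheaf.stalkSpecializes h).hom.toAlgebra
  obtain ⟨_, ⟨W, hW, rfl⟩, hxW, -⟩ :=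
    X.isBasis_affineOpens.exists_subset_of_mem_open (Set.mem_univ x) isOpen_univ
  have hyW : y ∈ W := h.mem_open W.isOpen hxW
  let := X.presheaf.algebra_section_stalk (⟨x, hxW⟩ : W)
  let := X.presheaf.algebra_section_stalk (⟨y, hyW⟩ : W)
  have hx := hW.isLocalization_stalk ⟨x, hxW⟩
  have hy := hW.isLocalization_stalk ⟨y, hyW⟩
  have htower : IsScalarTower Γ(X, W) (X.presheaf.stalk x) (X.presheaf.stalk y) :=
    IsScalarTower.of_algebraMap_eq' (congrArg CommRingCat.Hom.hom
      (X.presheaf.germ_stalkSpecializes hxW h)).symm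
  have hle : (hW.primeIdealOf ⟨x, hxW⟩).asIdeal.primeCompl ≤
      (hW.primeIdealOf ⟨y, hyW⟩).asIdeal.primeCompl := by
    intro r hr
    have h1 : IsUnit (algebraMap Γ(X, W) (X.presheaf.stalk x) r) :=
      (IsLocalization.AtPrime.isUnit_to_map_iff _ (hW.primeIdealOf ⟨x, hxW⟩).asIdeal r).2 hr
    have h2 := h1.map (algebraMap (X.presheaf.stalk x) (X.presheaf.stalk y))
    rw [← IsScalarTower.algebraMap_apply] at h2
    exact (IsLocalization.AtPrime.isUnit_to_map_iff _ (hW.primeIdealOf ⟨y, hyW⟩).asIdeal r).1 h2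
  have := IsLocalization.isLocalization_of_submonoid_le (X.presheaf.stalk x)
    (X.presheaf.stalk y) _ _ hle
  -- The stalk at `y` inverts the image of the complement of the prime of `y`; the remaining
  -- elements outside the pulled back maximal ideal are already units there.
  refine IsLocalization.of_le
    (Submonoid.map (algebraMap Γ(X, W) (X.presheaf.stalk x))
      (hW.primeIdealOf ⟨y, hyW⟩).asIdeal.primeCompl) _ ?_ ?_
  · rintro _ ⟨r, hr, rfl⟩ hmem
    have h1 : algebraMap (X.presheaf.stalk x) (X.presheaf.stalk y) (algebraMap Γ(X, W) _ r) ∈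
      maximalIdeal (X.presheaf.stalk y) := hmem
    rw [← IsScalarTower.algebraMap_apply] at h1
    exact hr ((IsLocalization.AtPrime.to_map_mem_maximal_iff _
      (hW.primeIdealOf ⟨y, hyW⟩).asIdeal r).1 h1)
  · intro a ha
    by_contra hu
    exact ha ((mem_maximalIdeal _).2 hu)

/-- The morphism `Spec A ⟶ X` given by a ring homomorphism `φ` on an affine chart pulls back
functions on the chart by `φ`. -/
theorem IsAffineOpen.stalkClosedPointTo_germ_SpecMap_fromSpec {X : Scheme.{u}} {W : X.Opens}
    (hW : IsAffineOpen W) {A : CommRingCat.{u}} [IsLocalRing A] (φ : Γ(X, W) ⟶ A)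
    (hx : (Spec.map φ ≫ hW.fromSpec) (closedPoint A) ∈ W) :
    X.presheaf.germ W _ hx ≫ Scheme.stalkClosedPointTo (Spec.map φ ≫ hW.fromSpec) = φ := by
  have h1 := Scheme.germ_stalkClosedPointTo_Spec φ
  rw [Scheme.stalkClosedPointTo_comp]
  erw [Scheme.Hom.germ_stalkMap_assoc]
  rw [hW.fromSpec_app_self, Category.assoc]
  erw [TopCat.Presheaf.germ_res_assoc]
  erw [h1]
  simp

end AlgebraicGeometry

/-! ### Exceptional components and pullback along arcs. -/

namespace NashArcs

open TopologicalSpace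

section Components

variable {X S : Scheme.{u}}

theorem isClosed_exceptionalLocus (p : X ⟶ S) : IsClosed (exceptionalLocus p) := by
  rw [← isOpen_compl_iff, isOpen_iff_forall_mem_open]
  intro x hx
  simp only [exceptionalLocus, Set.mem_compl_iff, Set.mem_ofPred_eq, not_forall, not_not] at hx
  obtain ⟨V, hxV, hV⟩ := hx
  exact ⟨p ⁻¹ᵁ V, fun y hy h => h V hy hV, (p ⁻¹ᵁ V).isOpen, hxV⟩

/-- The exceptional set has finitely many components, and they cover it. -/
theorem exists_finite_exceptionalComponents [NoetherianSpace X] (p : X ⟶ S) :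
    {E | IsExceptionalComponent p E}.Finite ∧
      ∀ x ∈ exceptionalLocus p, ∃ E, IsExceptionalComponent p E ∧ x ∈ E := by
  obtain ⟨F, hF, hcl, hirr, hU⟩ :=
    NoetherianSpace.exists_finite_set_isClosed_irreducible (isClosed_exceptionalLocus p)
  have hle (Z : Set X) (hZ : IsIrreducible Z ∧ Z ⊆ exceptionalLocus p) : ∃ T ∈ F, Z ⊆ T := by
    lift F to Finset (Set X) using hF
    exact isIrreducible_iff_sUnion_isClosed.1 hZ.1 F hcl (hU ▸ hZ.2)
  have hmem (T : Set X) (hT : T ∈ F) : IsClosed T ∧ IsIrreducible T ∧ T ⊆ exceptionalLocus p :=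
    ⟨hcl T hT, hirr T hT, hU ▸ Set.subset_sUnion_of_mem hT⟩
  refine ⟨hF.subset fun E (hE : IsExceptionalComponent p E) => ?_, fun x hx => ?_⟩
  · obtain ⟨T, hT, hET⟩ := hle E hE.1.2
    exact (Maximal.eq_of_ge hE (hmem T hT) hET) ▸ hT
  · rw [hU] at hx
    obtain ⟨T, hT, hxT⟩ := hx
    obtain ⟨M, hTM, hM⟩ := hF.exists_le_maximal hT
    refine ⟨M, ⟨hmem M hM.1, fun Z hZ hMZ => ?_⟩, hTM hxT⟩
    obtain ⟨T', hT', hZT'⟩ := hle Z hZ.2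
    exact hZT'.trans (hM.2 hT' (hMZ.trans hZT'))

/-- The generic point of an exceptional divisor has an affine neighbourhood that is disjoint from all
other exceptional components. -/
theorem ExceptionalDivisor.exists_isAffineOpen [NoetherianSpace X] {p : X ⟶ S}
    (E : ExceptionalDivisor p) {V : X.Opens} (hV : E.genericPoint ∈ V) :
    ∃ W : X.Opens, IsAffineOpen W ∧ W ≤ V ∧ E.genericPoint ∈ W ∧
      ∀ E', IsExceptionalComponent p E' → E' ≠ E.carrier → Disjoint (W : Set X) E' := by
  have hfin : {E' | IsExceptionalComponent p E' ∧ E' ≠ E.carrier}.Finite :=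
    (exists_finite_exceptionalComponents p).1.subset fun _ h => h.1
  have hcl : IsClosed (⋃ E' ∈ {E' | IsExceptionalComponent p E' ∧ E' ≠ E.carrier}, E') :=
    hfin.isClosed_biUnion fun E' h => h.1.1.1
  have hη : E.genericPoint ∈ (V : Set X) ∩
      (⋃ E' ∈ {E' | IsExceptionalComponent p E' ∧ E' ≠ E.carrier}, E')ᶜ := by
    -- A component through the generic point of `E` contains `E`, so by maximality it equals `E`.
    refine ⟨hV, fun hmem => ?_⟩
    obtain ⟨E', ⟨hE', hne⟩, hηE'⟩ := Set.mem_iUnion₂.1 hmem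
    refine hne (Maximal.eq_of_ge E.isComponent hE'.1 ?_)
    rw [← E.isGenericPoint.def]
    exact hE'.1.1.closure_subset_iff.2 (by simpa using hηE')
  obtain ⟨_, ⟨W, hW, rfl⟩, hηW, hWV⟩ :=
    X.isBasis_affineOpens.exists_subset_of_mem_open hη (V.isOpen.inter hcl.isOpen_compl)
  refine ⟨W, hW, fun x hx => (hWV hx).1, hηW, fun E' hE' hne => ?_⟩
  rw [Set.disjoint_left]
  intro x hx hxE'
  exact (hWV hx).2 (Set.mem_biUnion (show E' ∈ {E' | _} from ⟨hE', hne⟩) hxE')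

end Components

variable {k : Type u} [Field k] {X S : Scheme.{u}} {p : X ⟶ S} {s : S ⟶ Spec (CommRingCat.of k)}

theorem Arc.pullback_eq_of_comp {φ : Arc s} {ψ : Arc (p ≫ s)} (h : ψ.hom ≫ p = φ.hom)
    (U : S.Opens) (hU : φ.origin ∈ U) (hU' : ψ.origin ∈ p ⁻¹ᵁ U) (f : Γ(S, U)) :
    φ.pullback U hU f = ψ.pullback (p ⁻¹ᵁ U) hU' (p.app U f) := by
  obtain ⟨φ, hφ⟩ := φ
  subst h
  have h1 : S.presheaf.germ U _ hU ≫ Scheme.stalkClosedPointTo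
      (R := CommRingCat.of (PowerSeries k)) (ψ.hom ≫ p) =
      p.app U ≫ X.presheaf.germ (p ⁻¹ᵁ U) _ hU' ≫
        Scheme.stalkClosedPointTo (R := CommRingCat.of (PowerSeries k)) ψ.hom := by
    rw [Scheme.stalkClosedPointTo_comp]
    erw [Scheme.Hom.germ_stalkMap_assoc]
    rfl
  exact congrArg (fun g => g.hom f) h1

instance (φ : Arc s) : IsLocalHom φ.pullbackGerm :=
  Scheme.isLocalHom_stalkClosedPointTo' (R := PowerSeries k) φ.hom

theorem ExceptionalDivisor.idealAt_isPrime (E : ExceptionalDivisor p) (x : X)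
    (h : E.genericPoint ⤳ x) : (E.idealAt x h).IsPrime :=
  Ideal.comap_isPrime _ _

/-- Along an arc transverse to `E`, a function vanishes to order at least its order along `E`. -/
theorem ExceptionalDivisor.X_pow_dvd_pullback {E : ExceptionalDivisor p}
    (hreg : ∀ x : X, IsRegularLocalRing (X.presheaf.stalk x)) {ψ : Arc (p ≫ s)}
    (hψ : E.IsTransverse ψ) (V : X.Opens) (hV : ψ.origin ∈ V) (hη : E.genericPoint ∈ V)
    (f : Γ(X, V)) {n : ℕ}
    (hn : (n : ℕ∞) ≤ Ring.ord (X.presheaf.stalk E.genericPoint) (X.presheaf.germ V _ hη f)) :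
    PowerSeries.X ^ n ∣ ψ.pullback V hV f := by
  obtain ⟨h, hmap⟩ := hψ
  let := (X.presheaf.stalkSpecializes h).hom.toAlgebra
  have := hreg ψ.origin
  have := hreg E.genericPoint
  have := E.idealAt_isPrime ψ.origin h
  have : IsLocalization.AtPrime (X.presheaf.stalk E.genericPoint) (E.idealAt ψ.origin h) :=
    Scheme.isLocalization_stalkSpecializes h
  refine PowerSeries.X_pow_dvd_map_of_le_ord (B := X.presheaf.stalk E.genericPoint)
    (E.idealAt ψ.origin h) E.codim_one ψ.pullbackGerm hmap ?_
  have hgerm : algebraMap (X.presheaf.stalk ψ.origin) (X.presheaf.stalk E.genericPoint)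
      (X.presheaf.germ V ψ.origin hV f) = X.presheaf.germ V _ hη f :=
    congrArg (fun g => g.hom f) (X.presheaf.germ_stalkSpecializes hV h)
  rwa [hgerm]

theorem Arc.isOpen_inequation {U : S.Opens} (hU : IsAffineOpen U)
    (P : MvPolynomial (Γ(S, U) × ℕ) k) : IsOpen (Arc.inequation s U P) :=
  TopologicalSpace.isOpen_generateFrom_of_mem ⟨U, hU, P, rfl⟩

end NashArcs

/-! ### Existence of transverse arcs, and the conclusion. -/

namespace NashArcs

open TopologicalSpace

variable {k : Type u} [Field k] {X S : Scheme.{u}} {p : X ⟶ S} {s : S ⟶ Spec (CommRingCat.of k)}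

/-- There is an arc transverse to a given exceptional divisor and disjoint from all other
exceptional components, along which a given function vanishes to exactly its order along the
divisor. -/
theorem ExceptionalDivisor.exists_isTransverse [IsAlgClosed k] [NoetherianSpace X]
    [LocallyOfFiniteType (p ≫ s)] (hreg : ∀ x : X, IsRegularLocalRing (X.presheaf.stalk x))
    (E : ExceptionalDivisor p) {V : X.Opens} (hη : E.genericPoint ∈ V) (f : Γ(X, V)) {n : ℕ}
    (hn : Ring.ord (X.presheaf.stalk E.genericPoint) (X.presheaf.germ V _ hη f) = n) :
    ∃ ψ : Arc (p ≫ s), ψ.hom (discGeneric k) ∉ exceptionalLocus p ∧ E.IsTransverse ψ ∧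
      (∀ E' : Set X, IsExceptionalComponent p E' → E' ≠ E.carrier →
        Disjoint (Set.range ψ.hom) E') ∧
      ∃ hV : ψ.origin ∈ V, PowerSeries.coeff n (ψ.pullback V hV f) ≠ 0 := by
  -- The arc will factor through `W`, so it avoids all other exceptional components.
  obtain ⟨W, hW, hWV, hηW, hdisj⟩ := E.exists_isAffineOpen hη
  let ρ : CommRingCat.of k ⟶ Γ(X, W) :=
    (Scheme.ΓSpecIso (CommRingCat.of k)).inv ≫ (p ≫ s).appLE ⊤ W le_top
  let : Algebra k Γ(X, W) := ρ.hom.toAlgebra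
  have hft : Algebra.FiniteType k Γ(X, W) :=
    ((p ≫ s).finiteType_appLE (isAffineOpen_top _) hW le_top).comp
      (RingHom.FiniteType.of_surjective _
        (Scheme.ΓSpecIso (CommRingCat.of k)).symm.commRingCatIsoToRingEquiv.surjective)
  have hρ : Spec.map ρ = hW.fromSpec ≫ p ≫ s := by
    have h1 := IsAffineOpen.SpecMap_appLE_fromSpec (p ≫ s) (isAffineOpen_top _) hW le_top
    rw [IsAffineOpen.fromSpec_top, Scheme.isoSpec_Spec_inv, ← Spec.map_comp] at h1
    exact h1
  let y := hW.primeIdealOf ⟨E.genericPoint, hηW⟩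
  have hy : hW.fromSpec y = E.genericPoint := hW.fromSpec_primeIdealOf ⟨E.genericPoint, hηW⟩
  let := X.presheaf.algebra_section_stalk (⟨E.genericPoint, hηW⟩ : W)
  have hloc : IsLocalization.AtPrime (X.presheaf.stalk E.genericPoint) y.asIdeal :=
    hW.isLocalization_stalk ⟨E.genericPoint, hηW⟩
  have hregW (Q : Ideal Γ(X, W)) [hQ : Q.IsPrime] :
      IsRegularLocalRing (Localization.AtPrime Q) := by
    have hx : hW.fromSpec ⟨Q, hQ⟩ ∈ W := (hW.isoSpec.inv _).2
    let := X.presheaf.algebra_section_stalk (⟨_, hx⟩ : W)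
    have h1 : IsLocalization.AtPrime (X.presheaf.stalk (hW.fromSpec ⟨Q, hQ⟩)) Q :=
      hW.isLocalization_stalk' ⟨Q, hQ⟩ hx
    have := hreg (hW.fromSpec ⟨Q, hQ⟩)
    exact .of_ringEquiv (IsLocalization.algEquiv Q.primeCompl
      (X.presheaf.stalk (hW.fromSpec ⟨Q, hQ⟩)) (Localization.AtPrime Q)).toRingEquiv
  let f' : Γ(X, W) := X.presheaf.map (homOfLE hWV).op f
  have hn' : Ring.ord (X.presheaf.stalk E.genericPoint)
      (algebraMap Γ(X, W) (X.presheaf.stalk E.genericPoint) f') = n := by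
    rw [← hn]
    exact congrArg _ (X.presheaf.germ_res_apply (homOfLE hWV) _ hηW f)
  obtain ⟨φ, hφP, ⟨h, hhP, hφh⟩, hφf⟩ := Algebra.FiniteType.exists_algHom_powerSeries (k := k)
    y.asIdeal hregW (X.presheaf.stalk E.genericPoint) E.codim_one hn'
  let φ' : Γ(X, W) ⟶ CommRingCat.of (PowerSeries k) := CommRingCat.ofHom φ.toRingHom
  let ψ : Arc (p ≫ s) :=
    { hom := Spec.map φ' ≫ hW.fromSpec
      comp_eq := by
        rw [Category.assoc, ← hρ, ← Spec.map_comp]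
        exact congrArg Spec.map (CommRingCat.hom_ext (RingHom.ext fun c => φ.commutes c)) }
  have hmemW (z : disc k) : ψ.hom z ∈ W := by
    have : hW.fromSpec (Spec.map φ' z) ∈ Set.range hW.fromSpec := ⟨_, rfl⟩
    rwa [hW.range_fromSpec] at this
  have horW : ψ.origin ∈ W := hmemW _
  have hgerm (g : Γ(X, W)) : ψ.pullbackGerm (X.presheaf.germ W _ horW g) = φ g :=
    congrArg (fun q => q.hom g) (hW.stalkClosedPointTo_germ_SpecMap_fromSpec φ' horW)
  have hle : y.asIdeal ≤ (IsLocalRing.maximalIdeal (PowerSeries k)).comap φ := fun a ha => by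
    rw [Ideal.mem_comap, IsLocalRing.mem_maximalIdeal, mem_nonunits_iff,
      PowerSeries.isUnit_iff_constantCoeff, PowerSeries.X_dvd_iff.1 (hφP a ha)]
    exact not_isUnit_zero
  have hspec : E.genericPoint ⤳ ψ.origin := by
    have h1 : y ⤳ Spec.map φ' (discClosed k) := (PrimeSpectrum.le_iff_specializes _ _).1 hle
    exact hy ▸ h1.map hW.fromSpec.continuous
  have hmem (r : Γ(X, W)) :
      X.presheaf.germ W _ horW r ∈ E.idealAt ψ.origin hspec ↔ r ∈ y.asIdeal := by
    rw [← IsLocalization.AtPrime.to_map_mem_maximal_iff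
      (X.presheaf.stalk E.genericPoint) y.asIdeal]
    exact iff_of_eq (congrArg (· ∈ IsLocalRing.maximalIdeal (X.presheaf.stalk E.genericPoint))
      (congrArg (fun q => q.hom r) (X.presheaf.germ_stalkSpecializes horW hspec)))
  refine ⟨ψ, ?_, ?_, ?_, ⟨hWV horW, ?_⟩⟩
  · intro hexc
    obtain ⟨E', hE', hmemE⟩ := (exists_finite_exceptionalComponents p).2 _ hexc
    have hEE' : E' = E.carrier := by
      by_contra hne
      exact Set.disjoint_left.1 (hdisj E' hE' hne) (hmemW _) hmemE
    rw [hEE', ← E.isGenericPoint.def] at hmemE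
    -- If the generic point of the arc lay on `E`, all of the ideal of `E` would map to zero,
    -- whereas `h` maps to `X`.
    have h1 : hW.fromSpec y ⤳ hW.fromSpec (Spec.map φ' (discGeneric k)) :=
      hy ▸ specializes_iff_mem_closure.2 hmemE
    have h2 : φ h = 0 := (PrimeSpectrum.le_iff_specializes y _).2
      (hW.fromSpec.isOpenEmbedding.isInducing.specializes_iff.1 h1) hhP
    exact PowerSeries.X_ne_zero (hφh.symm.trans h2)
  · refine ⟨hspec, le_antisymm (Ideal.map_le_iff_le_comap.2 fun a ha => ?_) ?_⟩
    · let := X.presheaf.algebra_section_stalk (⟨ψ.origin, horW⟩ : W)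
      have hlocx := hW.isLocalization_stalk ⟨ψ.origin, horW⟩
      -- A germ in the ideal of `E` is a fraction whose numerator lies in `P` and whose denominator
      -- pulls back to a unit.
      obtain ⟨⟨r, t⟩, hrt⟩ := IsLocalization.surj
        (hW.primeIdealOf ⟨ψ.origin, horW⟩).asIdeal.primeCompl a
      have hrt' : a * X.presheaf.germ W _ horW t = X.presheaf.germ W _ horW r := hrt
      have hu : IsUnit (φ t) := by
        rw [← hgerm]
        exact (IsLocalization.map_units (X.presheaf.stalk ψ.origin) t).map ψ.pullbackGerm
      have hr : r ∈ y.asIdeal := (hmem r).1 (hrt' ▸ Ideal.mul_mem_right _ _ ha)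
      have h1 := congrArg ψ.pullbackGerm hrt'
      rw [map_mul, hgerm, hgerm] at h1
      rw [Ideal.mem_comap, Ideal.mem_span_singleton]
      exact hu.dvd_mul_right.1 (h1 ▸ hφP r hr)
    · rw [Ideal.span_singleton_le_iff_mem]
      have h1 := Ideal.mem_map_of_mem ψ.pullbackGerm ((hmem h).2 hhP)
      rwa [hgerm, hφh] at h1
  · intro E' hE' hne
    refine (hdisj E' hE' hne).mono_left ?_
    rintro _ ⟨z, rfl⟩
    exact hmemW z
  · have h1 : ψ.pullback V (hWV horW) f = φ f' := by
      rw [← hgerm]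
      exact congrArg ψ.pullbackGerm (X.presheaf.germ_res_apply (homOfLE hWV) _ horW f).symm
    rwa [h1]

theorem isNoetherian_of_finiteType {k : Type u} [Field k] {X : Scheme.{u}}
    (f : X ⟶ Spec (CommRingCat.of k)) [LocallyOfFiniteType f] [QuasiCompact f] :
    IsNoetherian X := by
  have := LocallyOfFiniteType.isLocallyNoetherian f
  have : CompactSpace X := (quasiCompact_iff_compactSpace (f := f)).1 ‹_›
  exact {}

end NashArcs

theorem mainTheorem1 {k : Type u} [Field k] [IsAlgClosed k]
    {S X : Scheme.{u}} (s : S ⟶ Spec (CommRingCat.of k))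
    [IsReduced S] [IsSeparated s] [LocallyOfFiniteType s] [QuasiCompact s]
    (p : X ⟶ S) (hp : NashArcs.IsDesingularization p)
    (U : S.Opens) (hU : IsAffineOpen U)
    (Ei Ej : NashArcs.ExceptionalDivisor p)
    (hi : (((p ⁻¹ᵁ U : X.Opens) : Set X) ∩ Ei.carrier).Nonempty)
    (hj : (((p ⁻¹ᵁ U : X.Opens) : Set X) ∩ Ej.carrier).Nonempty)
    (hf : ∃ f : Γ(S, U), Ei.ord U hi f < Ej.ord U hj f) :
    ¬ closure (NashArcs.arcFamily s Ei) ⊆ closure (NashArcs.arcFamily s Ej) := by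
  intro hsub
  obtain ⟨f, hlt⟩ := hf
  -- Only the order along `E_i` must be finite; along `E_j` the bound `n + 1` is enough, so infinite
  -- order is allowed.
  obtain ⟨n, hn⟩ := ENat.ne_top_iff_exists.1 hlt.ne_top
  have := hp.isProper
  have : IsNoetherian X := NashArcs.isNoetherian_of_finiteType (p ≫ s)
  obtain ⟨ψ, hgen, htrans, hdisj, hV, hcoeff⟩ := Ei.exists_isTransverse (s := s) hp.isRegular
    (Ei.genericPoint_mem hi) (p.app U f) hn.symm
  let φ : NashArcs.Arc s := ⟨ψ.hom ≫ p, by rw [Category.assoc, ψ.comp_eq]⟩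
  let W := NashArcs.Arc.inequation s U (MvPolynomial.X (f, n))
  have hφW : φ ∈ W := by
    refine ⟨hV, ?_⟩
    rw [MvPolynomial.eval_X, NashArcs.Arc.pullback_eq_of_comp (φ := φ) (ψ := ψ) rfl U hV hV]
    exact hcoeff
  have hφ : φ ∈ closure (NashArcs.arcFamily s Ej) :=
    hsub (subset_closure ⟨ψ, ⟨rfl, hgen⟩, htrans, hdisj⟩)
  -- The neighbourhood `W` of `φ` would contain an arc of `N_j`, whose coefficient at `n` must
  -- vanish.
  obtain ⟨φ', ⟨hU', hne⟩, ψ', ⟨hcomp, -⟩, htrans', -⟩ :=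
    mem_closure_iff.1 hφ W (NashArcs.Arc.isOpen_inequation hU _) hφW
  have hV' : ψ'.origin ∈ p ⁻¹ᵁ U := by
    obtain ⟨φ', hφ'⟩ := φ'
    subst hcomp
    exact hU'
  rw [MvPolynomial.eval_X, NashArcs.Arc.pullback_eq_of_comp hcomp U hU' hV'] at hne
  refine hne (PowerSeries.X_pow_dvd_iff.1 (NashArcs.ExceptionalDivisor.X_pow_dvd_pullback
    hp.isRegular htrans' _ hV' (Ej.genericPoint_mem hj) (p.app U f) (n := n + 1) ?_) n
    (Nat.lt_succ_self n))
  rw [← hn] at hlt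
  exact_mod_cast Order.add_one_le_of_lt hlt
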